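/- Write $\{a,b\}^*$ for the set of all words over $\{a,b\}$. For words $w,x,y\in\{a,b\}^*$, let $w[x,y]$ denote the word obtained from $w$ by substituting $x$ for every letter $a$ and $y$ for every letter $b$. A semigroup identity $p=q$ is a pair of distinct non-empty words $p,q$ over an alphabet $\Sigma$; a semigroup $S$ satisfies it if every semigroup morphism from the semigroup $\Sigma^+$ of non-empty words to $S$ maps $p$ and $q$ to the same element. Let $\mathbb{T}=\mathbb{R}\cup\{-\infty\}$ be the tropical semiring, with maximum as addition and $+$ as multiplication, and let $UT_4(\mathbb{T})$ be the semigroup of $4\times 4$ matrices over $\mathbb{T}$ all of whose entries below the diagonal are $-\infty$, under matrix multiplication. Let $\mathbb{P}_4$ be the plactic monoid of rank $4$, that is, the monoid generated by $\{1,2,3,4\}$ subject to the Knuth relations $yzx=yxz$ for $x<y\le z$ and $zxy=xzy$ for $x\le y<z$. Theorem. Let $u,v\in\{a,b\}^*$ be such that $u[ab,ba]=v[ab,ba]$ is a semigroup identity satisfied by $UT_4(\mathbb{T})$. Then $(abuab)[ab,ba]=(abvab)[ab,ba]$ is a semigroup identity satisfied by $\mathbb{P}_4$. -/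

import Mathlib

/-- The tropical semiring `ℝ ∪ {-∞}` with addition `max` and multiplication `+`.
Mathlib's `Tropical R` uses `min` for the order of `R`; here this is the order dual of `ℝ` with an
added top element, so the addition is `max` for the usual order of `ℝ`, and the added element is
`-∞`, the zero of the semiring. -/
abbrev MaxPlus : Type := Tropical (WithTop ℝᵒᵈ)

/-- `UT_n(𝕋)`: the `n` by `n` tropical matrices with `-∞` below the diagonal. -/
def UT (n : ℕ) : Submonoid (Matrix (Fin n) (Fin n) MaxPlus) where
  carrier := {A | ∀ i j, j < i → A i j = 0}
  one_mem' := fun _ _ hij => Matrix.one_apply_ne hij.ne'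
  mul_mem' := by
    intro A B hA hB i j hij
    rw [Matrix.mul_apply]
    refine Finset.sum_eq_zero fun k _ => ?_
    rcases lt_or_ge k i with hk | hk
    · rw [hA i k hk, zero_mul]
    · rw [hB k j (hij.trans_le hk), mul_zero]

/-- The Knuth relations on words over an ordered alphabet. -/
inductive KnuthRel {α : Type*} [LinearOrder α] : FreeMonoid α → FreeMonoid α → Prop
  | bca_bac (a b c : α) (hab : a < b) (hbc : b ≤ c) :
      KnuthRel (FreeMonoid.of b * FreeMonoid.of c * FreeMonoid.of a)
        (FreeMonoid.of b * FreeMonoid.of a * FreeMonoid.of c)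
  | cab_acb (a b c : α) (hab : a ≤ b) (hbc : b < c) :
      KnuthRel (FreeMonoid.of c * FreeMonoid.of a * FreeMonoid.of b)
        (FreeMonoid.of a * FreeMonoid.of c * FreeMonoid.of b)

/-- The plactic monoid `ℙ_n` of rank `n`; the ordered set of generators `{1, …, n}` is `Fin n`. -/
abbrev PlacticMonoid (n : ℕ) : Type := PresentedMonoid (KnuthRel (α := Fin n))

/-- The free semigroup `Σ⁺` of non-empty words, inside the free monoid `Σ*` of all words. -/
def NonemptyWords (α : Type*) : Subsemigroup (FreeMonoid α) where
  carrier := {w | w ≠ 1}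
  mul_mem' := by
    intro x y hx _ h
    exact hx (List.append_eq_nil_iff.mp h).1

/-- `u = v` is a semigroup identity (a pair of distinct non-empty words) which is satisfied by `S`:
every morphism from the semigroup of non-empty words to `S` takes the same value at `u` and `v`. -/
def SatisfiesIdentity (S : Type*) [Semigroup S] {α : Type*} (u v : FreeMonoid α) : Prop :=
  ∃ (hu : u ∈ NonemptyWords α) (hv : v ∈ NonemptyWords α),
    u ≠ v ∧ ∀ φ : NonemptyWords α →ₙ* S, φ ⟨u, hu⟩ = φ ⟨v, hv⟩

/-- The alphabet `{a, b}`. -/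
inductive AB : Type
  | a
  | b

/-- The one-letter word `a`. -/
def wa : FreeMonoid AB := FreeMonoid.of AB.a

/-- The one-letter word `b`. -/
def wb : FreeMonoid AB := FreeMonoid.of AB.b

/-- `w[x, y]`: the word obtained from `w ∈ {a,b}*` by substituting `x` for `a` and `y` for `b`. -/
def wordSubst (w x y : FreeMonoid AB) : FreeMonoid AB :=
  FreeMonoid.lift (fun l : AB => match l with
    | AB.a => x
    | AB.b => y) w

/-!
The plactic monoid of rank four is represented by upper triangular tropical matrices indexed by the
`k`-element subsets of the alphabet, for `k = 1, 2, 3`. The `(P, Q)` entry of the matrix of a letter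
`x` is `-∞` unless `P ≤ Q`, and otherwise `1` or `0` according to whether `x` belongs to some member
of the interval `[P, Q]`. For the matrix of a word, `n` is at most the `(P, Q)` entry when a path
of subsets from `P` to `Q` collects a total weight of at least `n`; this is the relation `Scores`.
It is invariant under the Knuth relations (`scores_iff_of_plac_eq`). Every word is equal in the
plactic monoid to the row reading of a tableau (`exists_tableau`), and a few entries determine the
tableau, because they give the number of small letters in its first rows
(`plac_eq_of_scores_iff`).

An identity of `UT 4` holds for all weights on a chain of four states
(`SatisfiesIdentity.scores_iff`). This settles the one-element and the three-element subsets, which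
form chains of length four. The two-element subsets form the poset
`01 < 02 < {03, 12} < 13 < 23`, in which every proper interval is covered by chains of length four
(`Scores.wt₂_of_forall`), so only the entry from `01` to `23` remains.

For this entry the padding matters. Let the letters `a`, `b` be mapped to `x`, `y`, so that the
identity to be proved has the form `xyyx s xyyx = xyyx t xyyx`, where `s` and `t` are products of
factors `xy` and `yx`. The first step out of `01` and the last step into `23` both replace the
letter `1` by `2`. If `xy` has at least as many letters `1` as `2`, it is advantageous to put off
the last step until the final `xyyx`; otherwise it is advantageous to take the first step
already in the initial `xyyx`. Hence an optimal path may be assumed to cross `s` inside a proper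
interval, where `s` may be exchanged for `t` (`Scores.wt₂_of_forall_of_pad`).
-/

/-! ### Scores of words along chains of states -/

/-- `Scores c w P Q n`: reading `w` while moving up in the preorder of states, from `P` to some
state below `Q`, can collect a total weight of at least `n`, where reading the letter `x` during a
move from `R` to `S` has weight `c R S x`. In other words, `n` is at most the `(P, Q)` entry of a
product of tropical matrices, the last of which has entry `0` wherever it is not `-∞`. -/
def Scores {σ α : Type*} [Preorder σ] (c : σ → σ → α → ℤ) : List α → σ → σ → ℤ → Prop
  | [], P, Q, n => P ≤ Q ∧ n ≤ 0
  | x :: w, P, Q, n => ∃ R, P ≤ R ∧ Scores c w R Q (n - c P R x)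

/-- Weights that can only grow when the interval of states grows. -/
def IntervalMono {σ α : Type*} [Preorder σ] (c : σ → σ → α → ℤ) : Prop :=
  ∀ ⦃P' P Q Q' : σ⦄, P' ≤ P → P ≤ Q → Q ≤ Q' → ∀ x, c P Q x ≤ c P' Q' x

namespace Scores

variable {σ τ α : Type*} [Preorder σ] [Preorder τ] {c : σ → σ → α → ℤ} {c' : τ → τ → α → ℤ}
  {w w₁ w₂ : List α} {P P' Q Q' R : σ} {m n : ℤ}

theorem le (h : Scores c w P Q n) : P ≤ Q := by
  induction w generalizing P n with
  | nil => exact h.1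
  | cons x w ih => obtain ⟨R, hR, h⟩ := h; exact hR.trans (ih h)

theorem anti (hmn : m ≤ n) (h : Scores c w P Q n) : Scores c w P Q m := by
  induction w generalizing P m n with
  | nil => exact ⟨h.1, hmn.trans h.2⟩
  | cons x w ih => obtain ⟨R, hR, h⟩ := h; exact ⟨R, hR, ih (by omega) h⟩

theorem mono_left (hc : IntervalMono c) (hP : P' ≤ P) (h : Scores c w P Q n) :
    Scores c w P' Q n := by
  cases w with
  | nil => exact ⟨hP.trans h.1, h.2⟩
  | cons x w =>
    obtain ⟨R, hR, h⟩ := h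
    exact ⟨R, hP.trans hR, h.anti (by have := hc hP hR le_rfl x; omega)⟩

theorem mono_right (hQ : Q ≤ Q') (h : Scores c w P Q n) : Scores c w P Q' n := by
  induction w generalizing P n with
  | nil => exact ⟨h.1.trans hQ, h.2⟩
  | cons x w ih => obtain ⟨R, hR, h⟩ := h; exact ⟨R, hR, ih h⟩

theorem append (hc : IntervalMono c) (h₁ : Scores c w₁ P R m) (h₂ : Scores c w₂ R Q n) :
    Scores c (w₁ ++ w₂) P Q (m + n) := by
  induction w₁ generalizing P m with
  | nil => exact (h₂.mono_left hc h₁.1).anti (by have := h₁.2; omega)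
  | cons x w ih =>
    obtain ⟨S, hS, h⟩ := h₁
    exact ⟨S, hS, (ih h).anti (by omega)⟩

theorem exists_of_append (h : Scores c (w₁ ++ w₂) P Q n) :
    ∃ R m k, Scores c w₁ P R m ∧ Scores c w₂ R Q k ∧ n = m + k := by
  induction w₁ generalizing P n with
  | nil => exact ⟨P, 0, n, ⟨le_rfl, le_rfl⟩, h, by omega⟩
  | cons x w ih =>
    obtain ⟨S, hS, h⟩ := h
    obtain ⟨R, m, k, h₁, h₂, e⟩ := ih h
    exact ⟨R, m + c P S x, k, ⟨S, hS, h₁.anti (by omega)⟩, h₂, by omega⟩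

/-- Scores are transported by a map of states that is well behaved on the interval `[P, Q]`. -/
theorem map (f : σ → τ)
    (hf : ∀ R S, P ≤ R → R ≤ S → S ≤ Q → f R ≤ f S ∧ ∀ x, c R S x ≤ c' (f R) (f S) x)
    (h : Scores c w P Q n) : Scores c' w (f P) (f Q) n := by
  induction w generalizing P n with
  | nil => exact ⟨(hf P Q le_rfl h.1 le_rfl).1, h.2⟩
  | cons x w ih =>
    obtain ⟨R, hR, h⟩ := h
    have hPR := hf P R le_rfl hR h.le
    refine ⟨f R, hPR.1, (ih (fun S T hS hT hQ => hf S T (hR.trans hS) hT hQ) h).anti ?_⟩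
    have := hPR.2 x
    omega

theorem stay (c : σ → σ → α → ℤ) (w : List α) (P : σ) :
    Scores c w P P (w.map (c P P)).sum := by
  induction w with
  | nil => exact ⟨le_rfl, le_rfl⟩
  | cons x w ih => exact ⟨P, le_rfl, ih.anti (by simp)⟩

theorem le_sum (hc : IntervalMono c) (h : Scores c w P Q n) : n ≤ (w.map (c P Q)).sum := by
  suffices H : ∀ {P₀ : σ}, P₀ ≤ P → n ≤ (w.map (c P₀ Q)).sum from H le_rfl
  induction w generalizing P n with
  | nil => intro _ _; simpa using h.2
  | cons x w ih =>
    intro P₀ h₀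
    obtain ⟨R, hR, h⟩ := h
    have h₁ := ih h (h₀.trans hR)
    have h₂ := hc h₀ hR h.le x
    simp only [List.map_cons, List.sum_cons]
    omega

end Scores

/-! ### Three systems of weights on four letters -/

/-- The two-element subsets of `Fin 4`, as increasing pairs ordered componentwise. -/
abbrev Duo : Type := {p : Fin 4 × Fin 4 // p.1 < p.2}

/-- The two-element set `{i, j}`, where `i < j`. -/
abbrev duo (i j : Fin 4) (h : i < j := by decide) : Duo := ⟨(i, j), h⟩

/-- The weight for chains of one-element sets: `x` counts if it lies in `[p, q]`. -/
def wt₁ (p q x : Fin 4) : ℤ := if p ≤ x ∧ x ≤ q then 1 else 0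

/-- The weight for chains of two-element sets: `x` counts if it belongs to a member of the
interval `[P, Q]`. -/
def wt₂ (P Q : Duo) (x : Fin 4) : ℤ :=
  if (P.1.1 ≤ x ∧ x ≤ Q.1.1) ∨ (P.1.2 ≤ x ∧ x ≤ Q.1.2) then 1 else 0

/-- The weight for chains of three-element sets, where the state `i` stands for the complement of
`{i.rev}`: every letter belongs to a member of the interval `[i, j]`, except the missing one if
`i = j`. -/
def wt₃ (i j x : Fin 4) : ℤ := if i = j ∧ x = i.rev then 0 else 1

theorem wt₁_mono : IntervalMono wt₁ := by
  unfold IntervalMono; decide +kernel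

theorem wt₂_mono : IntervalMono wt₂ := by
  unfold IntervalMono; decide +kernel

theorem wt₃_mono : IntervalMono wt₃ := by
  unfold IntervalMono; decide +kernel

/-! ### Invariance under the Knuth relations -/

/-- Every chain of four states gives the three-letter word `x y z` at most the weight which some
chain with the same ends gives to `x' y' z'`. -/
def TripleLE {σ α : Type*} [Preorder σ] (c : σ → σ → α → ℤ) (x y z x' y' z' : α) : Prop :=
  ∀ P R, P ≤ R → ∀ S, R ≤ S → ∀ Q, S ≤ Q → ∃ R', P ≤ R' ∧ ∃ S', R' ≤ S' ∧ S' ≤ Q ∧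
    c P R x + c R S y + c S Q z ≤ c P R' x' + c R' S' y' + c S' Q z'

instance {σ α : Type*} [Preorder σ] [Fintype σ] [DecidableLE σ] (c : σ → σ → α → ℤ)
    (x y z x' y' z' : α) : Decidable (TripleLE c x y z x' y' z') := by
  unfold TripleLE; infer_instance

/-- The inequalities between weights which make scores invariant under the Knuth relations. -/
def KnuthStable {σ α : Type*} [Preorder σ] [LinearOrder α] (c : σ → σ → α → ℤ) : Prop :=
  ∀ x y z : α,
    (x < y → y ≤ z → TripleLE c y z x y x z ∧ TripleLE c y x z y z x) ∧
    (x ≤ y → y < z → TripleLE c z x y x z y ∧ TripleLE c x z y z x y)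

theorem wt₁_knuthStable : KnuthStable wt₁ := by
  unfold KnuthStable; decide +kernel

set_option synthInstance.maxHeartbeats 400000 in
set_option synthInstance.maxSize 2000 in
theorem wt₂_knuthStable : KnuthStable wt₂ := by
  unfold KnuthStable; decide +kernel

theorem wt₃_knuthStable : KnuthStable wt₃ := by
  unfold KnuthStable; decide +kernel

theorem Scores.triple_of_tripleLE {σ α : Type*} [Preorder σ] {c : σ → σ → α → ℤ}
    (hc : IntervalMono c) {x y z x' y' z' : α} (H : TripleLE c x y z x' y' z') {P Q : σ} {n : ℤ}
    (h : Scores c [x, y, z] P Q n) : Scores c [x', y', z'] P Q n := by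
  obtain ⟨R, hR, S, hS, T, hT, hQ, hn⟩ := h
  obtain ⟨R', hR', S', hS', hS'Q, hle⟩ := H P R hR S hS Q (hT.trans hQ)
  refine ⟨R', hR', S', hS', Q, hS'Q, le_rfl, ?_⟩
  have := hc le_rfl hT hQ z
  omega

/-- Words with the same scores form a congruence of the free monoid. -/
def scoresCon {σ α : Type*} [Preorder σ] (c : σ → σ → α → ℤ) (hc : IntervalMono c) :
    Con (FreeMonoid α) where
  r s t := ∀ P Q n, Scores c s.toList P Q n ↔ Scores c t.toList P Q n
  iseqv := ⟨fun _ _ _ _ => Iff.rfl, fun h P Q n => (h P Q n).symm,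
    fun h k P Q n => (h P Q n).trans (k P Q n)⟩
  mul' := by
    have key : ∀ {s s' t t' : FreeMonoid α},
        (∀ P Q n, Scores c s.toList P Q n ↔ Scores c s'.toList P Q n) →
        (∀ P Q n, Scores c t.toList P Q n ↔ Scores c t'.toList P Q n) → ∀ P Q n,
        Scores c (s * t).toList P Q n → Scores c (s' * t').toList P Q n := by
      intro s s' t t' h k P Q n H
      rw [FreeMonoid.toList_mul] at H ⊢
      obtain ⟨R, m, l, h₁, h₂, rfl⟩ := Scores.exists_of_append H
      exact Scores.append hc ((h _ _ _).1 h₁) ((k _ _ _).1 h₂)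
    intro s s' t t' h k P Q n
    exact ⟨key h k P Q n, key (fun P Q n => (h P Q n).symm) (fun P Q n => (k P Q n).symm) P Q n⟩

/-- The element of the plactic monoid given by a word. -/
def plac {α : Type*} [LinearOrder α] (w : List α) : PresentedMonoid (KnuthRel (α := α)) :=
  PresentedMonoid.mk KnuthRel (FreeMonoid.ofList w)

theorem plac_append {α : Type*} [LinearOrder α] (s t : List α) :
    plac (s ++ t) = plac s * plac t := by
  simp [plac, FreeMonoid.ofList_append]

theorem scores_iff_of_plac_eq {σ α : Type*} [Preorder σ] [LinearOrder α] {c : σ → σ → α → ℤ}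
    (hc : IntervalMono c) (hk : KnuthStable c) {s t : List α} (h : plac s = plac t) (P Q : σ)
    (n : ℤ) : Scores c s P Q n ↔ Scores c t P Q n := by
  have hle : conGen (KnuthRel (α := α)) ≤ scoresCon c hc := by
    refine Con.conGen_le.2 fun s t hst P Q n => ?_
    cases hst with
    | bca_bac x y z hxy hyz =>
      have H := (hk x y z).1 hxy hyz
      exact ⟨Scores.triple_of_tripleLE hc H.1, Scores.triple_of_tripleLE hc H.2⟩
    | cab_acb x y z hxy hyz =>
      have H := (hk x y z).2 hxy hyz
      exact ⟨Scores.triple_of_tripleLE hc H.1, Scores.triple_of_tripleLE hc H.2⟩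
  exact hle ((Con.eq _).1 h) P Q n

/-! ### Row insertion and tableaux -/

section Insertion

variable {α : Type*} [LinearOrder α]

theorem plac_bca {x y z : α} (hxy : x < y) (hyz : y ≤ z) : plac [y, z, x] = plac [y, x, z] :=
  (Con.eq _).2 (ConGen.Rel.of _ _ (KnuthRel.bca_bac x y z hxy hyz))

theorem plac_cab {x y z : α} (hxy : x ≤ y) (hyz : y < z) : plac [z, x, y] = plac [x, z, y] :=
  (Con.eq _).2 (ConGen.Rel.of _ _ (KnuthRel.cab_acb x y z hxy hyz))

/-- A letter moves to the left past the entries of a row that are greater, except the first. -/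
theorem plac_cons_append_singleton {x y : α} {t : List α} (ht : (y :: t).Pairwise (· ≤ ·))
    (hxy : x < y) : plac (y :: (t ++ [x])) = plac (y :: x :: t) := by
  induction t generalizing y with
  | nil => rfl
  | cons z t ih =>
    have hyz : y ≤ z := (List.pairwise_cons.1 ht).1 z (by simp)
    have h := ih (List.pairwise_cons.1 ht).2 (hxy.trans_le hyz)
    calc plac ([y] ++ (z :: (t ++ [x]))) = plac ([y] ++ (z :: x :: t)) := by
          rw [plac_append, h, ← plac_append]
      _ = plac ([y, z, x] ++ t) := rfl
      _ = plac ([y, x, z] ++ t) := by rw [plac_append, plac_bca hxy hyz, ← plac_append]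

/-- The letter `y` moves to the left past smaller letters in weakly increasing order, if they are
followed by a letter `x < y` which is at least as large as each of them. -/
theorem plac_append_pair {x y : α} {s : List α} (hs : s.Pairwise (· ≤ ·)) (hsx : ∀ a ∈ s, a ≤ x)
    (hxy : x < y) : plac (s ++ [y, x]) = plac (y :: (s ++ [x])) := by
  induction s with
  | nil => rfl
  | cons a s ih =>
    have h := ih (List.pairwise_cons.1 hs).2 (fun b hb => hsx b (by simp [hb]))
    obtain ⟨b, l, hbl, hab, hby⟩ : ∃ b l, s ++ [x] = b :: l ∧ a ≤ b ∧ b < y := by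
      cases s with
      | nil => exact ⟨x, [], rfl, hsx a (by simp), hxy⟩
      | cons b s =>
        exact ⟨b, s ++ [x], rfl, (List.pairwise_cons.1 hs).1 b (by simp),
          (hsx b (by simp)).trans_lt hxy⟩
    calc plac ([a] ++ (s ++ [y, x])) = plac ([a] ++ (y :: (s ++ [x]))) := by
          rw [plac_append, h, ← plac_append]
      _ = plac ([a, y, b] ++ l) := by rw [hbl]; rfl
      _ = plac ([y, a, b] ++ l) := by rw [plac_append, ← plac_cab hab hby, ← plac_append]
      _ = plac (y :: a :: (s ++ [x])) := by rw [hbl]; rfl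

/-- `Dominates r₁ r₂`: the row `r₁` of a tableau may stand on top of the row `r₂`, that is, `r₂` is
not longer than `r₁` and each entry of `r₂` is greater than the entry of `r₁` above it. For
weakly increasing rows this is expressed by counting entries. -/
def Dominates (r₁ r₂ : List α) : Prop :=
  ∀ v, r₂.countP (· ≤ v) ≤ r₁.countP (· < v)

theorem exists_split_or_append {r : List α} (hr : r.Pairwise (· ≤ ·)) (x : α) :
    (∀ a ∈ r, a ≤ x) ∨ ∃ s y t, r = s ++ y :: t ∧ (∀ a ∈ s, a ≤ x) ∧ x < y := by
  induction r with
  | nil => simp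
  | cons a r ih =>
    rcases lt_or_ge x a with h | h
    · exact Or.inr ⟨[], a, r, rfl, by simp, h⟩
    · rcases ih (List.pairwise_cons.1 hr).2 with H | ⟨s, y, t, rfl, hs, hy⟩
      · exact Or.inl (by simpa [h] using H)
      · exact Or.inr ⟨a :: s, y, t, rfl, by simpa [h] using hs, hy⟩

/-- Insertion of the letter `x` into the row `r`: either `x` is appended, or it replaces
an entry `y > x`, which moves to the front of the word. The inequalities between counts are those
that keep the rows of a tableau dominating each other. -/
theorem exists_row_insertion {r : List α} (hr : r.Pairwise (· ≤ ·)) (x : α) :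
    ∃ r' : List α, r'.Pairwise (· ≤ ·) ∧ (∀ v, r.countP (· < v) ≤ r'.countP (· < v)) ∧
      (∀ v, r'.countP (· ≤ v) ≤ r.countP (· ≤ v) ∨
        x ≤ v ∧ r'.countP (· ≤ v) ≤ r.countP (· ≤ x) + 1) ∧
      (plac r * plac [x] = plac r' ∨ ∃ y, x < y ∧
        r.countP (· < y) + 1 ≤ r'.countP (· < y) ∧ plac r * plac [x] = plac [y] * plac r') := by
  rcases exists_split_or_append hr x with h | ⟨s, y, t, rfl, hs, hy⟩
  · refine ⟨r ++ [x], ?_, fun v => by simp, fun v => ?_, Or.inl (plac_append _ _).symm⟩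
    · exact List.pairwise_append.2 ⟨hr, by simp, by simpa using h⟩
    · rcases lt_or_ge v x with hv | hv
      · left; simp [hv.not_ge]
      · right
        have e : r.countP (· ≤ x) = r.length := by
          rw [List.countP_eq_length]; simpa using h
        have := r.countP_le_length (p := (· ≤ v))
        refine ⟨hv, ?_⟩
        simp only [List.countP_append, List.countP_cons, List.countP_nil, e]
        split_ifs <;> omega
  · obtain ⟨hs', hyt, hst⟩ := List.pairwise_append.1 hr
    have hyt' := List.pairwise_cons.1 hyt
    have hxt : ∀ b ∈ t, x < b := fun b hb => hy.trans_le (hyt'.1 b hb)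
    refine ⟨s ++ x :: t, ?_, fun v => ?_, fun v => ?_, Or.inr ⟨y, hy, ?_, ?_⟩⟩
    · refine List.pairwise_append.2 ⟨hs', List.pairwise_cons.2 ⟨fun b hb => (hxt b hb).le, hyt'.2⟩,
        fun a ha b hb => ?_⟩
      rcases List.mem_cons.1 hb with rfl | hb
      · exact hs a ha
      · exact hst a ha b (by simp [hb])
    · simp only [List.countP_append, List.countP_cons, decide_eq_true_eq]
      have : y < v → x < v := hy.trans
      split_ifs <;> first | omega | (exfalso; tauto)
    · simp only [List.countP_append, List.countP_cons, decide_eq_true_eq]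
      have htx : t.countP (· ≤ x) = 0 := by
        rw [List.countP_eq_zero]; intro b hb; simpa using hxt b hb
      have hsx : s.countP (· ≤ x) = s.length := by
        rw [List.countP_eq_length]; simpa using hs
      have hsv := s.countP_le_length (p := (· ≤ v))
      rcases lt_or_ge v x with hv | hv
      · left; simp [hv.not_ge]
      · rcases lt_or_ge v y with hvy | hvy
        · right
          have htv : t.countP (· ≤ v) = 0 := by
            rw [List.countP_eq_zero]
            intro b hb
            simpa using hvy.trans_le (hyt'.1 b hb)
          refine ⟨hv, ?_⟩
          rw [htx, hsx, htv]
          split_ifs <;> omega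
        · left; simp [hv, hvy]
    · have hty : t.countP (· < y) = 0 := by
        rw [List.countP_eq_zero]; intro b hb; simpa using hyt'.1 b hb
      simp [hty, hy]
    · rw [← plac_append, ← plac_append]
      calc plac ((s ++ y :: t) ++ [x]) = plac (s ++ (y :: (t ++ [x]))) := by simp
        _ = plac (s ++ (y :: x :: t)) := by
          rw [plac_append, plac_cons_append_singleton hyt hy, ← plac_append]
        _ = plac ((s ++ [y, x]) ++ t) := by simp
        _ = plac ((y :: (s ++ [x])) ++ t) := by
          rw [plac_append, plac_append_pair hs' hs hy, ← plac_append]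
        _ = plac ([y] ++ (s ++ x :: t)) := by simp

theorem Dominates.mono_left {r₁ r₁' r₂ : List α} (h : Dominates r₁ r₂)
    (h' : ∀ v, r₁.countP (· < v) ≤ r₁'.countP (· < v)) : Dominates r₁' r₂ :=
  fun v => (h v).trans (h' v)

theorem Dominates.insert {r₁ r₂ r₂' : List α} {x : α} (h : Dominates r₁ r₂)
    (hx : r₂.countP (· ≤ x) + 1 ≤ r₁.countP (· < x))
    (h' : ∀ v, r₂'.countP (· ≤ v) ≤ r₂.countP (· ≤ v) ∨
      x ≤ v ∧ r₂'.countP (· ≤ v) ≤ r₂.countP (· ≤ x) + 1) : Dominates r₁ r₂' := by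
  intro v
  rcases h' v with hv | ⟨hxv, hv⟩
  · exact hv.trans (h v)
  · refine hv.trans (hx.trans (List.countP_mono_left fun a _ ha => ?_))
    simp only [decide_eq_true_eq] at ha ⊢
    exact ha.trans_le hxv

end Insertion

/-- Four rows that form a semistandard tableau. -/
structure IsTableau (r₁ r₂ r₃ r₄ : List (Fin 4)) : Prop where
  sorted₁ : r₁.Pairwise (· ≤ ·)
  sorted₂ : r₂.Pairwise (· ≤ ·)
  sorted₃ : r₃.Pairwise (· ≤ ·)
  sorted₄ : r₄.Pairwise (· ≤ ·)
  dominates₁ : Dominates r₁ r₂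
  dominates₂ : Dominates r₂ r₃
  dominates₃ : Dominates r₃ r₄

/-- Every word is equal in the plactic monoid to the row reading of a tableau. -/
theorem exists_tableau (w : List (Fin 4)) : ∃ r₁ r₂ r₃ r₄, IsTableau r₁ r₂ r₃ r₄ ∧
    plac w = plac (r₄ ++ r₃ ++ r₂ ++ r₁) := by
  induction w using List.reverseRecOn with
  | nil =>
    exact ⟨[], [], [], [], ⟨by simp, by simp, by simp, by simp, fun _ => le_rfl, fun _ => le_rfl,
      fun _ => le_rfl⟩, rfl⟩
  | append_singleton w x ih =>
    obtain ⟨r₁, r₂, r₃, r₄, ⟨s₁, s₂, s₃, s₄, d₁, d₂, d₃⟩, hw⟩ := ih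
    simp only [plac_append] at hw
    simp only [plac_append, hw]
    -- The letter bumped out of a row satisfies the hypothesis of `Dominates.insert` below it.
    have bump : ∀ {r r' r₀ : List (Fin 4)} {y : Fin 4}, Dominates r r₀ →
        r.countP (· < y) + 1 ≤ r'.countP (· < y) →
        r₀.countP (· ≤ y) + 1 ≤ r'.countP (· < y) :=
      fun hd h => (Nat.add_le_add_right (hd _) 1).trans h
    obtain ⟨t₁, s₁', l₁, g₁, e₁ | ⟨y₁, hy₁, b₁, e₁⟩⟩ := exists_row_insertion s₁ x
    · exact ⟨t₁, r₂, r₃, r₄, ⟨s₁', s₂, s₃, s₄, d₁.mono_left l₁, d₂, d₃⟩, by simp only [mul_assoc, e₁]⟩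
    obtain ⟨t₂, s₂', l₂, g₂, e₂ | ⟨y₂, hy₂, b₂, e₂⟩⟩ := exists_row_insertion s₂ y₁
    · refine ⟨t₁, t₂, r₃, r₄, ⟨s₁', s₂', s₃, s₄, (d₁.mono_left l₁).insert (bump d₁ b₁) g₂,
        d₂.mono_left l₂, d₃⟩, ?_⟩
      rw [mul_assoc, e₁, ← mul_assoc, mul_assoc _ (plac r₂), e₂]
    obtain ⟨t₃, s₃', l₃, g₃, e₃ | ⟨y₃, hy₃, b₃, e₃⟩⟩ := exists_row_insertion s₃ y₂
    · refine ⟨t₁, t₂, t₃, r₄, ⟨s₁', s₂', s₃', s₄, (d₁.mono_left l₁).insert (bump d₁ b₁) g₂,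
        (d₂.mono_left l₂).insert (bump d₂ b₂) g₃, d₃.mono_left l₃⟩, ?_⟩
      rw [mul_assoc, e₁, ← mul_assoc, mul_assoc _ (plac r₂), e₂, ← mul_assoc,
        mul_assoc _ (plac r₃), e₃]
    obtain ⟨t₄, s₄', l₄, g₄, e₄ | ⟨y₄, hy₄, b₄, e₄⟩⟩ := exists_row_insertion s₄ y₃
    · refine ⟨t₁, t₂, t₃, t₄, ⟨s₁', s₂', s₃', s₄', (d₁.mono_left l₁).insert (bump d₁ b₁) g₂,
        (d₂.mono_left l₂).insert (bump d₂ b₂) g₃, (d₃.mono_left l₃).insert (bump d₃ b₃) g₄⟩, ?_⟩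
      rw [mul_assoc, e₁, ← mul_assoc, mul_assoc _ (plac r₂), e₂, ← mul_assoc,
        mul_assoc _ (plac r₃), e₃, ← mul_assoc, e₄]
    · -- The bumped letters increase strictly, so none leaves the fourth row.
      omega

/-! ### Scores determine the tableau -/

theorem sum_map_eq_count (f : Fin 4 → ℤ) (r : List (Fin 4)) :
    (r.map f).sum = r.count 0 * f 0 + r.count 1 * f 1 + r.count 2 * f 2 + r.count 3 * f 3 := by
  induction r with
  | nil => simp
  | cons a r ih =>
    simp only [List.map_cons, List.sum_cons, ih, List.count_cons]
    fin_cases a <;> simp <;> ring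

theorem countP_eq_count (p : Fin 4 → Bool) (r : List (Fin 4)) :
    (r.countP p : ℤ) = r.count 0 * (if p 0 then 1 else 0) + r.count 1 * (if p 1 then 1 else 0) +
      r.count 2 * (if p 2 then 1 else 0) + r.count 3 * (if p 3 then 1 else 0) := by
  rw [← sum_map_eq_count (fun x => if p x then 1 else 0)]
  induction r with
  | nil => simp
  | cons a r ih => simp [List.countP_cons, ih, add_comm]

theorem eq_replicate_of_sorted {r : List (Fin 4)} (hr : r.Pairwise (· ≤ ·)) :
    r = List.replicate (r.count 0) 0 ++ (List.replicate (r.count 1) 1 ++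
      (List.replicate (r.count 2) 2 ++ List.replicate (r.count 3) 3)) := by
  refine List.Perm.eq_of_pairwise (le := (· ≤ ·)) (fun _ _ _ _ => le_antisymm) hr ?_ ?_
  · simp [List.pairwise_append, List.pairwise_replicate]
    rintro - b (⟨-, rfl⟩ | ⟨-, rfl⟩) <;> decide
  · rw [List.perm_iff_count]
    intro a
    fin_cases a <;> simp [List.count_replicate]

theorem eq_of_sorted_of_count_eq {r r' : List (Fin 4)} (hr : r.Pairwise (· ≤ ·))
    (hr' : r'.Pairwise (· ≤ ·)) (h : ∀ i, r.count i = r'.count i) : r = r' := by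
  rw [eq_replicate_of_sorted hr, eq_replicate_of_sorted hr', h, h, h, h]

theorem Scores.row {σ : Type*} [Preorder σ] {c : σ → σ → Fin 4 → ℤ} (hc : IntervalMono c)
    {r : List (Fin 4)} (hr : r.Pairwise (· ≤ ·)) {P₀ P₁ P₂ P₃ : σ} (h₁ : P₀ ≤ P₁) (h₂ : P₁ ≤ P₂)
    (h₃ : P₂ ≤ P₃) : Scores c r P₀ P₃ (r.count 0 * c P₀ P₀ 0 + (r.count 1 * c P₁ P₁ 1 +
      (r.count 2 * c P₂ P₂ 2 + r.count 3 * c P₃ P₃ 3))) := by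
  have key : ∀ (m : ℕ) (x : Fin 4) (P Q : σ), P ≤ Q →
      Scores c (List.replicate m x) P Q (m * c P P x) := by
    intro m x P Q hPQ
    have := (Scores.stay c (List.replicate m x) P).mono_right hPQ
    simpa using this
  conv in Scores c r => rw [eq_replicate_of_sorted hr]
  exact (key _ _ _ _ h₁).append hc ((key _ _ _ _ h₂).append hc ((key _ _ _ _ h₃).append hc
    (key _ _ _ _ le_rfl)))

theorem Dominates.count_le {r₁ r₂ : List (Fin 4)} (h : Dominates r₁ r₂) :
    r₂.count 0 = 0 ∧ r₂.count 1 ≤ r₁.count 0 ∧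
      r₂.count 1 + r₂.count 2 ≤ r₁.count 0 + r₁.count 1 ∧
      r₂.count 1 + r₂.count 2 + r₂.count 3 ≤ r₁.count 0 + r₁.count 1 + r₁.count 2 := by
  have h' : ∀ v, (r₂.countP (· ≤ v) : ℤ) ≤ r₁.countP (· < v) := fun v => by exact_mod_cast h v
  have h₀ := h' 0
  have h₁ := h' 1
  have h₂ := h' 2
  have h₃ := h' 3
  simp [countP_eq_count, -List.countP_eq_zero] at h₀ h₁ h₂ h₃
  omega

/-- Along each row of the word, the weight collected is at most that of the letters which belong to
a member of the interval between the states at the two ends of the row. -/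
theorem Scores.exists_le_of_rows {σ : Type*} [Preorder σ] {c : σ → σ → Fin 4 → ℤ}
    (hc : IntervalMono c) {r₁ r₂ r₃ r₄ : List (Fin 4)} {P Q : σ} {n : ℤ}
    (h : Scores c (r₄ ++ r₃ ++ r₂ ++ r₁) P Q n) :
    ∃ R S T : σ, P ≤ R ∧ R ≤ S ∧ S ≤ T ∧ T ≤ Q ∧ n ≤ (r₄.map (c P R)).sum +
      (r₃.map (c R S)).sum + (r₂.map (c S T)).sum + (r₁.map (c T Q)).sum := by
  obtain ⟨T, m₁, k₁, h, h₁, e₁⟩ := Scores.exists_of_append h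
  obtain ⟨S, m₂, k₂, h, h₂, e₂⟩ := Scores.exists_of_append h
  obtain ⟨R, m₃, k₃, h, h₃, e₃⟩ := Scores.exists_of_append h
  exact ⟨R, S, T, h.le, h₃.le, h₂.le, h₁.le, by
    linarith [h.le_sum hc, h₃.le_sum hc, h₂.le_sum hc, h₁.le_sum hc]⟩

/-- The three scores are the numbers of letters in the first row that are at most `1`, `2`, `3`. -/
theorem IsTableau.scores_wt₁_iff {r₁ r₂ r₃ r₄ : List (Fin 4)} (h : IsTableau r₁ r₂ r₃ r₄)
    (n : ℤ) :
    (Scores wt₁ (r₄ ++ r₃ ++ r₂ ++ r₁) 0 1 n ↔ n ≤ r₁.count 0 + r₁.count 1) ∧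
    (Scores wt₁ (r₄ ++ r₃ ++ r₂ ++ r₁) 0 2 n ↔ n ≤ r₁.count 0 + r₁.count 1 + r₁.count 2) ∧
    (Scores wt₁ (r₄ ++ r₃ ++ r₂ ++ r₁) 0 3 n ↔
      n ≤ r₁.count 0 + r₁.count 1 + r₁.count 2 + r₁.count 3) := by
  have d₁ := h.dominates₁.count_le
  have d₂ := h.dominates₂.count_le
  have d₃ := h.dominates₃.count_le
  -- Stay at `0` in the lower rows, and pass through the letters of the first row in turn.
  have lower : ∀ {P₁ P₂ P₃ : Fin 4}, 0 ≤ P₁ → P₁ ≤ P₂ → P₂ ≤ P₃ → _ := fun h₁ h₂ h₃ =>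
    ((((Scores.stay wt₁ r₄ 0).append wt₁_mono (Scores.stay wt₁ r₃ 0)).append wt₁_mono
      (Scores.stay wt₁ r₂ 0)).append wt₁_mono
      (Scores.row wt₁_mono h.sorted₁ (P₀ := 0) h₁ h₂ h₃))
  have upper := fun Q (H : Scores wt₁ (r₄ ++ r₃ ++ r₂ ++ r₁) 0 Q n) => H.exists_le_of_rows wt₁_mono
  simp only [sum_map_eq_count] at lower upper
  refine ⟨⟨fun H => ?_, fun hn => (lower (P₁ := 1) (P₂ := 1) (P₃ := 1) (by decide) le_rfl
    le_rfl).anti ?_⟩, ⟨fun H => ?_, fun hn => (lower (P₁ := 1) (P₂ := 2) (P₃ := 2) (by decide)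
    (by decide) le_rfl).anti ?_⟩, ⟨fun H => ?_, fun hn => (lower (P₁ := 1) (P₂ := 2) (P₃ := 3)
    (by decide) (by decide) (by decide)).anti ?_⟩⟩
  all_goals
    first
    | obtain ⟨R, S, T, -, hRS, hST, hTQ, hn⟩ := upper _ H
      clear upper lower H h
      fin_cases R <;> fin_cases S <;> first
        | (exfalso; revert hRS; decide)
        | (fin_cases T <;> first
            | (exfalso; revert hST; decide)
            | (exfalso; revert hTQ; decide)
            | (simp [wt₁] at hn; omega))
    | simp [wt₁]; omega

/-- The score from `{0, 1, 2}` to `{1, 2, 3}` is the total length of the first three rows. -/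
theorem IsTableau.scores_wt₃_iff {r₁ r₂ r₃ r₄ : List (Fin 4)} (h : IsTableau r₁ r₂ r₃ r₄)
    (n : ℤ) :
    Scores wt₃ (r₄ ++ r₃ ++ r₂ ++ r₁) 0 3 n ↔ n ≤ r₁.length + r₂.length + r₃.length := by
  have d₁ := h.dominates₁.count_le
  have d₂ := h.dominates₂.count_le
  have d₃ := h.dominates₃.count_le
  have hl : ∀ r : List (Fin 4),
      (r.length : ℤ) = r.count 0 + r.count 1 + r.count 2 + r.count 3 := fun r => by
    simpa using sum_map_eq_count (fun _ => 1) r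
  -- The largest element rises in the third row, the middle one in the second and the smallest one
  -- in the first.
  have lower := ((((Scores.stay wt₃ r₄ 0).append wt₃_mono
    (Scores.row wt₃_mono h.sorted₃ (P₀ := 0) (P₁ := 0) (P₂ := 0) (P₃ := 1) le_rfl le_rfl
      (by decide))).append wt₃_mono
    (Scores.row wt₃_mono h.sorted₂ (P₁ := 1) (P₂ := 2) (P₃ := 2) le_rfl (by decide)
      le_rfl)).append wt₃_mono
    (Scores.row wt₃_mono h.sorted₁ (P₁ := 3) (P₂ := 3) (P₃ := 3) (by decide) le_rfl le_rfl))
  have upper := fun H : Scores wt₃ (r₄ ++ r₃ ++ r₂ ++ r₁) 0 3 n => H.exists_le_of_rows wt₃_mono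
  simp only [sum_map_eq_count] at lower upper
  rw [hl, hl, hl]
  refine ⟨fun H => ?_, fun hn => lower.anti ?_⟩
  · obtain ⟨R, S, T, -, hRS, hST, hTQ, hn⟩ := upper H
    clear upper lower H h hl
    fin_cases R <;> fin_cases S <;> first
      | (exfalso; revert hRS; decide)
      | (fin_cases T <;> first
          | (exfalso; revert hST; decide)
          | (simp [wt₃, Fin.ext_iff] at hn; omega))
  · simp [wt₃, Fin.ext_iff]; omega

theorem Duo.cases (P : Duo) : P = duo 0 1 ∨ P = duo 0 2 ∨
    P = duo 0 3 ∨ P = duo 1 2 ∨ P = duo 1 3 ∨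
    P = duo 2 3 := by
  revert P; decide

set_option maxHeartbeats 1600000 in
/-- The two scores are the numbers of letters in the first two rows that are at most `2`, `3`. -/
theorem IsTableau.scores_wt₂_iff {r₁ r₂ r₃ r₄ : List (Fin 4)} (h : IsTableau r₁ r₂ r₃ r₄)
    (n : ℤ) :
    (Scores wt₂ (r₄ ++ r₃ ++ r₂ ++ r₁) (duo 0 1) (duo 1 2) n ↔
      n ≤ r₁.count 0 + r₁.count 1 + r₁.count 2 + r₂.count 1 + r₂.count 2) ∧
    (Scores wt₂ (r₄ ++ r₃ ++ r₂ ++ r₁) (duo 0 1) (duo 2 3) n ↔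
      n ≤ r₁.count 0 + r₁.count 1 + r₁.count 2 + r₁.count 3 + r₂.count 1 + r₂.count 2 +
        r₂.count 3) := by
  have d₁ := h.dominates₁.count_le
  have d₂ := h.dominates₂.count_le
  have d₃ := h.dominates₃.count_le
  -- The larger element rises in the second row and the smaller one in the first.
  have lower : ∀ {P₁ P₂ P₃ Q₁ Q₂ Q₃ : Duo}, duo 0 1 ≤ P₁ → P₁ ≤ P₂ → P₂ ≤ P₃ →
      P₃ ≤ Q₁ → Q₁ ≤ Q₂ → Q₂ ≤ Q₃ → _ := fun h₁ h₂ h₃ k₁ k₂ k₃ =>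
    ((((Scores.stay wt₂ r₄ (duo 0 1)).append wt₂_mono (Scores.stay wt₂ r₃ _)).append
      wt₂_mono (Scores.row wt₂_mono h.sorted₂ h₁ h₂ h₃)).append wt₂_mono
      (Scores.row wt₂_mono h.sorted₁ k₁ k₂ k₃))
  have upper := fun Q (H : Scores wt₂ (r₄ ++ r₃ ++ r₂ ++ r₁) (duo 0 1) Q n) =>
    H.exists_le_of_rows wt₂_mono
  simp only [sum_map_eq_count] at lower upper
  refine ⟨⟨fun H => ?_, fun hn => (lower (P₁ := duo 0 1) (P₂ := duo 0 2)
    (P₃ := duo 0 2) (Q₁ := duo 1 2) (Q₂ := duo 1 2)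
    (Q₃ := duo 1 2) (by decide) (by decide) (by decide) (by decide) (by decide)
    (by decide)).anti ?_⟩, ⟨fun H => ?_, fun hn => (lower (P₁ := duo 0 1)
    (P₂ := duo 0 2) (P₃ := duo 0 3) (Q₁ := duo 1 3)
    (Q₂ := duo 2 3) (Q₃ := duo 2 3) (by decide) (by decide) (by decide)
    (by decide) (by decide) (by decide)).anti ?_⟩⟩
  all_goals
    first
    | obtain ⟨R, S, T, -, hRS, hST, hTQ, hn⟩ := upper _ H
      clear upper lower H h
      rcases Duo.cases R with rfl | rfl | rfl | rfl | rfl | rfl <;>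
      rcases Duo.cases S with rfl | rfl | rfl | rfl | rfl | rfl <;> first
        | (exfalso; revert hRS; decide)
        | (rcases Duo.cases T with rfl | rfl | rfl | rfl | rfl | rfl <;> first
            | (exfalso; revert hST; decide)
            | (exfalso; revert hTQ; decide)
            | (simp [wt₂] at hn; omega))
    | simp [wt₂]; omega

theorem scores_wt₁_self_iff (w : List (Fin 4)) (i : Fin 4) (n : ℤ) :
    Scores wt₁ w i i n ↔ n ≤ w.count i := by
  have e : (w.map (wt₁ i i)).sum = w.count i := by
    rw [sum_map_eq_count]
    fin_cases i <;> simp [wt₁]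
  exact ⟨fun h => e ▸ h.le_sum wt₁_mono, fun h => (e ▸ Scores.stay wt₁ w i).anti h⟩

/-- Finitely many scores determine a word up to the Knuth relations. -/
theorem plac_eq_of_scores_iff {w w' : List (Fin 4)}
    (h₁ : ∀ i j n, Scores wt₁ w i j n ↔ Scores wt₁ w' i j n)
    (h₂ : ∀ n, Scores wt₂ w (duo 0 1) (duo 1 2) n ↔
      Scores wt₂ w' (duo 0 1) (duo 1 2) n)
    (h₂' : ∀ n, Scores wt₂ w (duo 0 1) (duo 2 3) n ↔
      Scores wt₂ w' (duo 0 1) (duo 2 3) n)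
    (h₃ : ∀ n, Scores wt₃ w 0 3 n ↔ Scores wt₃ w' 0 3 n) : plac w = plac w' := by
  obtain ⟨r₁, r₂, r₃, r₄, hr, e⟩ := exists_tableau w
  obtain ⟨t₁, t₂, t₃, t₄, ht, e'⟩ := exists_tableau w'
  have eq₁ : ∀ i, (w.count i : ℤ) = w'.count i := fun i => eq_of_forall_le_iff fun n => by
    rw [← scores_wt₁_self_iff, ← scores_wt₁_self_iff, h₁]
  have cnt : ∀ {w r : List (Fin 4)}, plac w = plac r → ∀ i, (w.count i : ℤ) = r.count i :=
    fun h i => eq_of_forall_le_iff fun n => by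
      rw [← scores_wt₁_self_iff, ← scores_wt₁_self_iff,
        scores_iff_of_plac_eq wt₁_mono wt₁_knuthStable h]
  have c : ∀ i, (r₄.count i + r₃.count i + r₂.count i + r₁.count i : ℤ) =
      t₄.count i + t₃.count i + t₂.count i + t₁.count i := fun i => by
    have := (cnt e i).symm.trans ((eq₁ i).trans (cnt e' i))
    simp only [List.count_append, Nat.cast_add] at this
    omega
  replace h₁ := fun i j n => (scores_iff_of_plac_eq wt₁_mono wt₁_knuthStable e i j n).symm.trans
    ((h₁ i j n).trans (scores_iff_of_plac_eq wt₁_mono wt₁_knuthStable e' i j n))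
  replace h₂ := fun n => (scores_iff_of_plac_eq wt₂_mono wt₂_knuthStable e _ _ n).symm.trans
    ((h₂ n).trans (scores_iff_of_plac_eq wt₂_mono wt₂_knuthStable e' _ _ n))
  replace h₂' := fun n => (scores_iff_of_plac_eq wt₂_mono wt₂_knuthStable e _ _ n).symm.trans
    ((h₂' n).trans (scores_iff_of_plac_eq wt₂_mono wt₂_knuthStable e' _ _ n))
  replace h₃ := fun n => (scores_iff_of_plac_eq wt₃_mono wt₃_knuthStable e _ _ n).symm.trans
    ((h₃ n).trans (scores_iff_of_plac_eq wt₃_mono wt₃_knuthStable e' _ _ n))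
  have a₁ := eq_of_forall_le_iff fun n =>
    (hr.scores_wt₁_iff n).1.symm.trans ((h₁ 0 1 n).trans (ht.scores_wt₁_iff n).1)
  have a₂ := eq_of_forall_le_iff fun n =>
    (hr.scores_wt₁_iff n).2.1.symm.trans ((h₁ 0 2 n).trans (ht.scores_wt₁_iff n).2.1)
  have a₃ := eq_of_forall_le_iff fun n =>
    (hr.scores_wt₁_iff n).2.2.symm.trans ((h₁ 0 3 n).trans (ht.scores_wt₁_iff n).2.2)
  have b₂ := eq_of_forall_le_iff fun n =>
    (hr.scores_wt₂_iff n).1.symm.trans ((h₂ n).trans (ht.scores_wt₂_iff n).1)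
  have b₃ := eq_of_forall_le_iff fun n =>
    (hr.scores_wt₂_iff n).2.symm.trans ((h₂' n).trans (ht.scores_wt₂_iff n).2)
  have c₃ := eq_of_forall_le_iff fun n =>
    (hr.scores_wt₃_iff n).symm.trans ((h₃ n).trans (ht.scores_wt₃_iff n))
  have hl : ∀ r : List (Fin 4),
      (r.length : ℤ) = r.count 0 + r.count 1 + r.count 2 + r.count 3 := fun r => by
    simpa using sum_map_eq_count (fun _ => 1) r
  simp only [hl] at c₃
  have p₁ := hr.dominates₁.count_le
  have p₂ := hr.dominates₂.count_le
  have p₃ := hr.dominates₃.count_le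
  have q₁ := ht.dominates₁.count_le
  have q₂ := ht.dominates₂.count_le
  have q₃ := ht.dominates₃.count_le
  -- Content and scores are linear in the multiplicities of the letters in the rows, and with the
  -- zeros forced by dominance these linear equations determine the multiplicities.
  have c₀' := c 0
  have c₁' := c 1
  have c₂' := c 2
  have c₃' := c 3
  have f₁ : r₁ = t₁ := eq_of_sorted_of_count_eq hr.sorted₁ ht.sorted₁ fun i => by
    fin_cases i <;> simp <;> omega
  have f₂ : r₂ = t₂ := eq_of_sorted_of_count_eq hr.sorted₂ ht.sorted₂ fun i => by
    fin_cases i <;> simp <;> omega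
  have f₃ : r₃ = t₃ := eq_of_sorted_of_count_eq hr.sorted₃ ht.sorted₃ fun i => by
    fin_cases i <;> simp <;> omega
  have f₄ : r₄ = t₄ := eq_of_sorted_of_count_eq hr.sorted₄ ht.sorted₄ fun i => by
    fin_cases i <;> simp <;> omega
  rw [e, e', f₁, f₂, f₃, f₄]

/-! ### Upper triangular tropical matrices -/

/-- The real number `r` as an element of the tropical semiring. -/
def MaxPlus.ofReal (r : ℝ) : MaxPlus := Tropical.trop ((OrderDual.toDual r : ℝᵒᵈ) : WithTop ℝᵒᵈ)

/-- The upper triangular tropical matrix of the weights of a letter. -/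
def weightMatrix {N : ℕ} {α : Type*} (c : Fin N → Fin N → α → ℤ) (x : α) : UT N :=
  ⟨fun i j => if i ≤ j then MaxPlus.ofReal (c i j x) else 0, fun _ _ h => if_neg h.not_ge⟩

/-- The score of a word is an entry of the product of the matrices of its letters, followed by the
matrix of the zero weight, which allows for a move at the end of the word. -/
theorem scores_iff_weightMatrix {N : ℕ} {α : Type*} (c : Fin N → Fin N → α → ℤ)
    (w : FreeMonoid α) (x₀ : α) (i j : Fin N) (n : ℤ) :
    Scores c w.toList i j n ↔
      Tropical.untrop
        ((FreeMonoid.lift (weightMatrix c) w * weightMatrix (fun _ _ _ => 0) x₀).1 i j) ≤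
        ((OrderDual.toDual (n : ℝ) : ℝᵒᵈ) : WithTop ℝᵒᵈ) := by
  induction w using FreeMonoid.inductionOn' generalizing i n with
  | one =>
    rw [map_one (FreeMonoid.lift _), one_mul, FreeMonoid.toList_one]
    by_cases h : i ≤ j
    · simp only [Scores, weightMatrix, MaxPlus.ofReal, h, if_true, true_and,
        Tropical.untrop_trop, WithTop.coe_le_coe, OrderDual.toDual_le_toDual, Int.cast_le]
    · simp [Scores, weightMatrix, h]
  | of_mul x w ih =>
    rw [map_mul (FreeMonoid.lift _), FreeMonoid.lift_eval_of, mul_assoc, Submonoid.coe_mul,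
      Matrix.mul_apply, Finset.untrop_sum', Finset.inf_le_iff (WithTop.coe_lt_top _), FreeMonoid.toList_of_mul]
    simp only [Scores, ih, Finset.mem_univ, true_and, Function.comp_apply, Tropical.untrop_mul]
    refine exists_congr fun k => ?_
    by_cases h : i ≤ k
    · simp only [h, true_and, weightMatrix, if_true, MaxPlus.ofReal, Tropical.untrop_trop]
      generalize Tropical.untrop _ = y
      induction y with
      | top => simp
      | coe y =>
        rw [← WithTop.coe_add, WithTop.coe_le_coe, WithTop.coe_le_coe]
        induction y using OrderDual.rec with
        | toDual y => ?_
        rw [← toDual_add, OrderDual.toDual_le_toDual, OrderDual.toDual_le_toDual]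
        push_cast
        constructor <;> intro h <;> linarith
    · simp [h, weightMatrix]

/-- A morphism of semigroups from the non-empty words, given by the images of the letters. -/
def evalNonempty {S α : Type*} [Monoid S] (f : α → S) : NonemptyWords α →ₙ* S where
  toFun w := FreeMonoid.lift f w
  map_mul' _ _ := map_mul _ _ _

theorem SatisfiesIdentity.scores_iff {N : ℕ} {α β : Type*} {p q : FreeMonoid β}
    (h : SatisfiesIdentity (UT N) p q) (c : Fin N → Fin N → α → ℤ) (f : β → FreeMonoid α)
    (i j : Fin N) (n : ℤ) :
    Scores c (FreeMonoid.lift f p).toList i j n ↔ Scores c (FreeMonoid.lift f q).toList i j n := by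
  rcases isEmpty_or_nonempty α with hα | ⟨⟨x₀⟩⟩
  · have : ∀ w : FreeMonoid α, w.toList = [] := fun w =>
      List.eq_nil_iff_forall_not_mem.2 fun a => hα.elim a
    rw [this, this]
  · obtain ⟨hp, hq, -, H⟩ := h
    have e : ∀ w : FreeMonoid β, FreeMonoid.lift (weightMatrix c) (FreeMonoid.lift f w) =
        FreeMonoid.lift (fun b => FreeMonoid.lift (weightMatrix c) (f b)) w := fun w => by
      rw [← MonoidHom.comp_apply]
      congr 1
      ext b
      simp
    have := H (evalNonempty fun b => FreeMonoid.lift (weightMatrix c) (f b))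
    simp only [evalNonempty, MulHom.coe_mk] at this
    rw [scores_iff_weightMatrix c _ x₀, scores_iff_weightMatrix c _ x₀, e, e, this]

/-! ### Chains of two-element sets -/

/-- Suppose that the paths from `lo` to `hi` are covered by the chains `e b`, with common rank
function `g`. Then each score between `lo` and `hi` is a score in one of the chains. -/
theorem Scores.exists_chain {σ τ ι α : Type*} [Preorder σ] [Preorder τ] {c : σ → σ → α → ℤ}
    {e : ι → τ → σ} {g : σ → τ} {lo hi : σ} (hg : Monotone g)
    (h₁ : ∀ P, lo ≤ P → ∀ Q, P ≤ Q → Q ≤ hi → ∃ b, e b (g P) = P ∧ e b (g Q) = Q)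
    (h₂ : ∀ P, lo ≤ P → ∀ R, P ≤ R → ∀ Q, R ≤ Q → Q ≤ hi → ∀ b, e b (g R) = R → e b (g Q) = Q →
      ∃ b', e b' (g P) = P ∧ ∀ i, g R ≤ i → i ≤ g Q → e b' i = e b i)
    {w : List α} {P Q : σ} {n : ℤ} (hP : lo ≤ P) (hQ : Q ≤ hi) (h : Scores c w P Q n) :
    ∃ b, e b (g P) = P ∧ e b (g Q) = Q ∧
      Scores (fun i j x => c (e b i) (e b j) x) w (g P) (g Q) n := by
  induction w generalizing P n with
  | nil =>
    obtain ⟨b, hbP, hbQ⟩ := h₁ P hP Q h.1 hQ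
    exact ⟨b, hbP, hbQ, hg h.1, h.2⟩
  | cons x w ih =>
    obtain ⟨R, hR, h⟩ := h
    obtain ⟨b, hbR, hbQ, hb⟩ := ih (hP.trans hR) h
    obtain ⟨b', hbP, hbb⟩ := h₂ P hP R hR Q h.le hQ b hbR hbQ
    have hRQ := hg h.le
    have eR := hbb (g R) le_rfl hRQ
    have eQ := hbb (g Q) hRQ le_rfl
    refine ⟨b', hbP, eQ.trans hbQ, g R, hg hR, ?_⟩
    have hb' : Scores (fun i j x => c (e b' i) (e b' j) x) w (g R) (g Q) (n - c P R x) := by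
      refine Scores.map id (fun S T hS hST hT => ⟨hST, fun x => ?_⟩) hb
      simp only [id, hbb S hS (hST.trans hT), hbb T (hS.trans hST) hT, le_refl]
    simpa only [hbP, eR.trans hbR] using hb'

/-- The chains from `{0, 1}` to `{1, 3}`. -/
def lowChain (b : Bool) : Fin 4 → Duo :=
  ![duo 0 1, duo 0 2,
    if b then duo 0 3 else duo 1 2, duo 1 3]

/-- The rank function of the chains `lowChain b`. -/
def lowRank (P : Duo) : Fin 4 :=
  ⟨min (P.1.1 + P.1.2 - 1) 3, by omega⟩

/-- The chains from `{0, 2}` to `{2, 3}`. -/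
def highChain (b : Bool) : Fin 4 → Duo :=
  ![duo 0 2, if b then duo 0 3 else duo 1 2,
    duo 1 3, duo 2 3]

/-- The rank function of the chains `highChain b`. -/
def highRank (P : Duo) : Fin 4 :=
  ⟨min (P.1.1 + P.1.2 - 2) 3, by omega⟩

set_option synthInstance.maxHeartbeats 400000 in
set_option synthInstance.maxSize 2000 in
/-- If `t` has all the scores of `s` for weights on a chain of four states, then it has those for
two-element sets, except possibly from `{0, 1}` to `{2, 3}`: this is the only interval in which
there are chains of five sets. -/
theorem Scores.wt₂_of_forall {s t : List (Fin 4)}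
    (H : ∀ (c : Fin 4 → Fin 4 → Fin 4 → ℤ) i j n, Scores c s i j n → Scores c t i j n)
    {P Q : Duo} {n : ℤ} (hPQ : ¬(P = duo 0 1 ∧ Q = duo 2 3))
    (h : Scores wt₂ s P Q n) : Scores wt₂ t P Q n := by
  have key : ∀ {e : Bool → Fin 4 → Duo} {g : Duo → Fin 4}, (∀ b i j, i ≤ j → e b i ≤ e b j) →
      (∃ b, e b (g P) = P ∧ e b (g Q) = Q ∧
        Scores (fun i j x => wt₂ (e b i) (e b j) x) s (g P) (g Q) n) → Scores wt₂ t P Q n := by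
    rintro e g he ⟨b, hP, hQ, h⟩
    have := Scores.map (c' := wt₂) (e b) (fun R S _ hRS _ => ⟨he b R S hRS, fun _ => le_rfl⟩)
      (H _ _ _ _ h)
    rwa [hP, hQ] at this
  have cases : Q ≤ duo 1 3 ∨ duo 0 2 ≤ P := by
    clear h key; revert P Q; decide
  rcases cases with hQ | hP
  · refine key (e := lowChain) (g := lowRank) (by decide) (h.exists_chain
      (lo := duo 0 1) ?_ ?_ ?_ ?_ hQ)
    · unfold Monotone; decide
    · decide +kernel
    · decide +kernel
    · clear h hPQ key; revert P; decide
  · refine key (e := highChain) (g := highRank) (by decide) (h.exists_chain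
      (hi := duo 2 3) ?_ ?_ ?_ hP ?_)
    · unfold Monotone; decide
    · decide +kernel
    · decide +kernel
    · clear h hPQ key; revert Q; decide

/-- A path to `{2, 3}` may be stopped at `{1, 3}` before its last step, such that the rest of
the word is worth staying at `{2, 3}`. -/
theorem Scores.exists_split_last {w : List (Fin 4)} {P : Duo} {n : ℤ}
    (hP : P ≤ duo 1 3) (h : Scores wt₂ w P (duo 2 3) n) :
    ∃ p s m, w = p ++ s ∧ Scores wt₂ p P (duo 1 3) m ∧
      n ≤ m + (s.map (wt₂ (duo 2 3) (duo 2 3))).sum := by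
  induction w generalizing P n with
  | nil => exact ⟨[], [], 0, rfl, ⟨hP, le_rfl⟩, by simpa using h.2⟩
  | cons x w ih =>
    obtain ⟨R, hR, h⟩ := h
    have hR' : R ≤ duo 1 3 ∨ R = duo 2 3 := by
      clear h hR; revert R; decide
    rcases hR' with hR' | rfl
    · obtain ⟨p, s, m, rfl, hp, hn⟩ := ih hR' h
      exact ⟨x :: p, s, m + wt₂ P R x, rfl, ⟨R, hR, hp.anti (by omega)⟩, by omega⟩
    · have hn := h.le_sum wt₂_mono
      have hx : wt₂ P (duo 2 3) x ≤ wt₂ P (duo 1 3) x ∨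
          wt₂ P (duo 2 3) x ≤ wt₂ (duo 2 3) (duo 2 3) x := by
        clear hn h hR ih; revert P x; decide
      rcases hx with hx | hx
      · exact ⟨[x], w, wt₂ P (duo 1 3) x, rfl, ⟨_, hP, le_rfl, by simp⟩, by omega⟩
      · exact ⟨[], x :: w, 0, rfl, ⟨hP, le_rfl⟩, by simp only [List.map_cons, List.sum_cons]; omega⟩

/-- A path from `{0, 1}` may be started at `{0, 2}` after its first step, such that the
part of the word before that is worth staying at `{0, 1}`. -/
theorem Scores.exists_split_first {w : List (Fin 4)} {Q : Duo} {n : ℤ}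
    (hQ : duo 0 2 ≤ Q) (h : Scores wt₂ w (duo 0 1) Q n) :
    ∃ p s m, w = p ++ s ∧ Scores wt₂ s (duo 0 2) Q m ∧
      n ≤ (p.map (wt₂ (duo 0 1) (duo 0 1))).sum + m := by
  induction w generalizing n with
  | nil => exact ⟨[], [], 0, rfl, ⟨hQ, le_rfl⟩, by simpa using h.2⟩
  | cons x w ih =>
    obtain ⟨R, hR, h⟩ := h
    have hR' : duo 0 2 ≤ R ∨ R = duo 0 1 := by
      clear h hR; revert R; decide
    rcases hR' with hR' | rfl
    · have hx : wt₂ (duo 0 1) R x ≤ wt₂ (duo 0 2) R x ∨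
          wt₂ (duo 0 1) R x ≤ wt₂ (duo 0 1) (duo 0 1) x := by
        clear h hR ih; revert R x; decide
      rcases hx with hx | hx
      · exact ⟨[], x :: w, n, rfl, ⟨R, hR', h.anti (by omega)⟩, by simp⟩
      · exact ⟨[x], w, _, rfl, h.mono_left wt₂_mono hR', by simp; omega⟩
    · obtain ⟨p, s, m, rfl, hs, hn⟩ := ih h
      exact ⟨x :: p, s, m, rfl, hs, by simp only [List.map_cons, List.sum_cons]; omega⟩

/-! ### Products of two words in both orders -/

/-- The words substituted for the letters: `x y` for `a`, and `y x` for `b`. -/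
def swapBlock {α : Type*} (x y : List α) : AB → List α
  | AB.a => x ++ y
  | AB.b => y ++ x

theorem toList_lift_wordSubst {α : Type*} (f : AB → FreeMonoid α) (u : FreeMonoid AB) :
    (FreeMonoid.lift f (wordSubst u (wa * wb) (wb * wa))).toList =
      u.toList.flatMap (swapBlock (f AB.a).toList (f AB.b).toList) := by
  induction u using FreeMonoid.inductionOn' with
  | one => simp [wordSubst]
  | of_mul l u ih =>
    rw [wordSubst] at ih ⊢
    rw [map_mul, map_mul, FreeMonoid.toList_mul, ih]
    cases l <;> simp [wa, wb, swapBlock, FreeMonoid.toList_mul]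

/-- If `xy` has non-negative total weight, then a negative weight of a suffix of a product of factors
`xy` and `yx` is made up for by a prefix of `xyyx`. -/
theorem exists_prefix_of_suffix {α : Type*} (f : α → ℤ) {x y : List α}
    (hf : 0 ≤ ((x ++ y).map f).sum) {u : List AB} {p s : List α}
    (h : u.flatMap (swapBlock x y) = p ++ s) :
    ∃ p' s', (x ++ y) ++ (y ++ x) = p' ++ s' ∧ 0 ≤ (p'.map f).sum + (s.map f).sum := by
  simp only [List.map_append, List.sum_append] at hf
  have hu : ∀ u : List AB, 0 ≤ ((u.flatMap (swapBlock x y)).map f).sum := by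
    intro u
    induction u with
    | nil => simp
    | cons l u ih =>
      cases l <;>
        simp only [List.flatMap_cons, swapBlock, List.map_append, List.sum_append] <;> omega
  induction u generalizing p with
  | nil =>
    obtain ⟨rfl, rfl⟩ := List.append_eq_nil_iff.1 h.symm
    exact ⟨[], _, rfl, by simp⟩
  | cons l u ih =>
    rw [List.flatMap_cons] at h
    rcases List.append_eq_append_iff.1 h with ⟨q, -, hq⟩ | ⟨q, hq, rfl⟩
    · exact ih hq
    · have := hu u
      have hq' := congrArg (fun w => (w.map f).sum) hq
      simp only [List.map_append, List.sum_append] at hq' ⊢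
      -- The suffix starts in a block `p ++ q`, which is also a factor of the word `xyyx`.
      cases l <;> simp only [swapBlock, List.map_append, List.sum_append] at hq hq'
      · exact ⟨p, q ++ (y ++ x), by rw [hq]; simp, by omega⟩
      · exact ⟨(x ++ y) ++ p, q, by rw [hq]; simp, by
          simp only [List.map_append, List.sum_append]; omega⟩

/-- The mirror image of `exists_prefix_of_suffix`. -/
theorem exists_suffix_of_prefix {α : Type*} (f : α → ℤ) {x y : List α}
    (hf : 0 ≤ ((x ++ y).map f).sum) {u : List AB} {p s : List α}
    (h : u.flatMap (swapBlock x y) = p ++ s) :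
    ∃ p' s', (x ++ y) ++ (y ++ x) = p' ++ s' ∧ 0 ≤ (p.map f).sum + (s'.map f).sum := by
  simp only [List.map_append, List.sum_append] at hf
  induction u generalizing p with
  | nil =>
    obtain ⟨rfl, rfl⟩ := List.append_eq_nil_iff.1 h.symm
    exact ⟨_, [], (List.append_nil _).symm, by simp⟩
  | cons l u ih =>
    rw [List.flatMap_cons] at h
    rcases List.append_eq_append_iff.1 h with ⟨q, rfl, hq⟩ | ⟨q, hq, -⟩
    · obtain ⟨p', s', e, h'⟩ := ih hq
      refine ⟨p', s', e, ?_⟩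
      cases l <;> simp only [swapBlock, List.map_append, List.sum_append] <;> omega
    · have hq' := congrArg (fun w => (w.map f).sum) hq
      simp only [List.map_append, List.sum_append] at hq'
      cases l <;> simp only [swapBlock, List.map_append, List.sum_append] at hq hq'
      · exact ⟨p, q ++ (y ++ x), by rw [hq]; simp, by
          simp only [List.map_append, List.sum_append]; omega⟩
      · exact ⟨(x ++ y) ++ p, q, by rw [hq]; simp, by omega⟩

/-- The remaining scores, from `{0, 1}` to `{2, 3}`. A path which takes both its first and its last
step inside `s` is no better than one which takes its last step in the final `xyyx`, or one which
takes its first step in the initial `xyyx`, according to which of the letters `1` and `2` is more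
frequent in `xy`. -/
theorem Scores.wt₂_of_forall_of_pad {x y t : List (Fin 4)} {u : List AB}
    (H : ∀ (c : Fin 4 → Fin 4 → Fin 4 → ℤ) i j n,
      Scores c (u.flatMap (swapBlock x y)) i j n → Scores c t i j n) {n : ℤ}
    (h : Scores wt₂ (((x ++ y) ++ (y ++ x)) ++ u.flatMap (swapBlock x y) ++
      ((x ++ y) ++ (y ++ x))) (duo 0 1) (duo 2 3) n) :
    Scores wt₂ (((x ++ y) ++ (y ++ x)) ++ t ++ ((x ++ y) ++ (y ++ x)))
      (duo 0 1) (duo 2 3) n := by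
  obtain ⟨Q, m, m₃, h₁₂, h₃, rfl⟩ := Scores.exists_of_append h
  obtain ⟨P, m₁, m₂, h₁, h₂, rfl⟩ := Scores.exists_of_append h₁₂
  clear h h₁₂
  by_cases hPQ : P = duo 0 1 ∧ Q = duo 2 3
  swap
  · exact (h₁.append wt₂_mono (h₂.wt₂_of_forall H hPQ)).append wt₂_mono h₃
  obtain ⟨rfl, rfl⟩ := hPQ
  -- The difference between staying at `{1, 3}` or `{2, 3}`, and at `{0, 1}` or `{0, 2}`.
  let f : Fin 4 → ℤ := ![0, 1, -1, 0]
  have hf : ∀ r : List (Fin 4),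
      (r.map (wt₂ (duo 1 3) (duo 1 3))).sum =
        (r.map (wt₂ (duo 2 3) (duo 2 3))).sum + (r.map f).sum ∧
      (r.map (wt₂ (duo 0 2) (duo 0 2))).sum =
        (r.map (wt₂ (duo 0 1) (duo 0 1))).sum + (r.map (-f ·)).sum := by
    intro r
    simp only [sum_map_eq_count]
    simp [wt₂, f]
    omega
  have hneg : ∀ r : List (Fin 4), (r.map (-f ·)).sum = -(r.map f).sum := fun r => by
    simp only [sum_map_eq_count]; ring
  rcases le_total 0 ((x ++ y).map f).sum with h0 | h0
  · obtain ⟨p, s, m, hps, hp, hm⟩ := h₂.exists_split_last (by decide)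
    obtain ⟨p', s', e, h'⟩ := exists_prefix_of_suffix f h0 hps
    have k₂ := hp.append wt₂_mono (Scores.stay wt₂ s _)
    rw [← hps] at k₂
    have k₃ := ((Scores.stay wt₂ p' (duo 1 3)).mono_right
      (Q' := duo 2 3) (by decide)).append wt₂_mono (Scores.stay wt₂ s' _)
    have l₃ := h₃.le_sum wt₂_mono
    rw [e, List.map_append, List.sum_append] at l₃
    rw [← e] at k₃
    refine ((h₁.append wt₂_mono (k₂.wt₂_of_forall H (by decide))).append wt₂_mono k₃).anti ?_
    rw [(hf s).1, (hf p').1]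
    omega
  · obtain ⟨p, s, m, hps, hs, hm⟩ := h₂.exists_split_first (by decide)
    obtain ⟨p', s', e, h'⟩ := exists_suffix_of_prefix (-f ·) (by rw [hneg]; omega) hps
    have k₂ := (Scores.stay wt₂ p _).append wt₂_mono hs
    rw [← hps] at k₂
    have k₁ := ((Scores.stay wt₂ p' (duo 0 1)).mono_right
      (Q' := duo 0 2) (by decide)).append wt₂_mono (Scores.stay wt₂ s' _)
    have l₁ := h₁.le_sum wt₂_mono
    rw [e, List.map_append, List.sum_append] at l₁
    rw [← e] at k₁
    refine ((k₁.append wt₂_mono (k₂.wt₂_of_forall H (by decide))).append wt₂_mono h₃).anti ?_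
    rw [(hf s').2, (hf p).2]
    omega

theorem Scores.pad {σ α : Type*} [Preorder σ] {c : σ → σ → α → ℤ} (hc : IntervalMono c)
    {z s t : List α} {P Q : σ} {n : ℤ}
    (H : ∀ R S, P ≤ R → S ≤ Q → ∀ n, Scores c s R S n → Scores c t R S n)
    (h : Scores c (z ++ s ++ z) P Q n) : Scores c (z ++ t ++ z) P Q n := by
  obtain ⟨S, m, k, h₁₂, h₃, rfl⟩ := Scores.exists_of_append h
  obtain ⟨R, m', k', h₁, h₂, rfl⟩ := Scores.exists_of_append h₁₂
  exact (h₁.append hc (H R S h₁.le h₃.le _ h₂)).append hc h₃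

/-- Words with the same scores for all weights on a chain of four states are equal in the plactic
monoid of rank four after padding. -/
theorem plac_pad_eq {x y : List (Fin 4)} {u v : List AB}
    (H : ∀ (c : Fin 4 → Fin 4 → Fin 4 → ℤ) i j n,
      Scores c (u.flatMap (swapBlock x y)) i j n ↔ Scores c (v.flatMap (swapBlock x y)) i j n) :
    plac (((x ++ y) ++ (y ++ x)) ++ u.flatMap (swapBlock x y) ++ ((x ++ y) ++ (y ++ x))) =
      plac (((x ++ y) ++ (y ++ x)) ++ v.flatMap (swapBlock x y) ++ ((x ++ y) ++ (y ++ x))) := by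
  have h₁ := fun c i j n => (H c i j n).1
  have h₂ := fun c i j n => (H c i j n).2
  have hS : ∀ S : Duo, S ≤ duo 1 2 → S ≠ duo 2 3 := by decide
  refine plac_eq_of_scores_iff (fun i j n => ⟨?_, ?_⟩) (fun n => ⟨?_, ?_⟩) (fun n => ⟨?_, ?_⟩)
    (fun n => ⟨?_, ?_⟩)
  · exact Scores.pad wt₁_mono fun R S _ _ n => h₁ _ R S n
  · exact Scores.pad wt₁_mono fun R S _ _ n => h₂ _ R S n
  · exact Scores.pad wt₂_mono fun R S _ hSQ n => Scores.wt₂_of_forall h₁ fun h => hS S hSQ h.2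
  · exact Scores.pad wt₂_mono fun R S _ hSQ n => Scores.wt₂_of_forall h₂ fun h => hS S hSQ h.2
  · exact Scores.wt₂_of_forall_of_pad h₁
  · exact Scores.wt₂_of_forall_of_pad h₂
  · exact Scores.pad wt₃_mono fun R S _ _ n => h₁ _ R S n
  · exact Scores.pad wt₃_mono fun R S _ _ n => h₂ _ R S n

/-! ### Identities -/

theorem FreeMonoid.of_mem_nonemptyWords {α : Type*} (a : α) :
    FreeMonoid.of a ∈ NonemptyWords α :=
  FreeMonoid.of_ne_one a

theorem map_nonemptyWords_eq_lift {S α : Type*} [Monoid S] (φ : NonemptyWords α →ₙ* S)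
    (w : FreeMonoid α) (hw : w ∈ NonemptyWords α) :
    φ ⟨w, hw⟩ = FreeMonoid.lift (fun a => φ ⟨.of a, FreeMonoid.of_mem_nonemptyWords a⟩) w := by
  induction w using FreeMonoid.inductionOn' with
  | one => exact absurd rfl hw
  | of_mul a w ih =>
    rw [map_mul, FreeMonoid.lift_eval_of]
    by_cases h : w = 1
    · subst h
      simp
    · rw [← ih h, ← map_mul]
      rfl

theorem wordSubst_pad (u x y : FreeMonoid AB) :
    wordSubst (wa * wb * u * wa * wb) x y = x * y * wordSubst u x y * (x * y) := by
  simp [wordSubst, wa, wb, mul_assoc]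

theorem mainTheorem4 (u v : FreeMonoid AB)
    (h : SatisfiesIdentity (UT 4)
      (wordSubst u (wa * wb) (wb * wa)) (wordSubst v (wa * wb) (wb * wa))) :
    SatisfiesIdentity (PlacticMonoid 4)
      (wordSubst (wa * wb * u * wa * wb) (wa * wb) (wb * wa))
      (wordSubst (wa * wb * v * wa * wb) (wa * wb) (wb * wa)) := by
  have hne : ∀ w : FreeMonoid AB,
      wordSubst (wa * wb * w * wa * wb) (wa * wb) (wb * wa) ∈ NonemptyWords AB := fun w hw => by
    rw [wordSubst_pad] at hw
    simp [mul_assoc, wa] at hw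
  refine ⟨hne u, hne v, fun e => ?_, fun φ => ?_⟩
  · rw [wordSubst_pad, wordSubst_pad] at e
    obtain ⟨-, -, huv, -⟩ := h
    exact huv (mul_left_cancel (mul_right_cancel e))
  · choose f hf using fun l => PresentedMonoid.surjective_mk (rels := KnuthRel (α := Fin 4))
      (φ ⟨.of l, FreeMonoid.of_mem_nonemptyWords l⟩)
    have key : ∀ w : FreeMonoid AB, φ ⟨_, hne w⟩ =
        plac ((((f AB.a).toList ++ (f AB.b).toList) ++ ((f AB.b).toList ++ (f AB.a).toList)) ++
          w.toList.flatMap (swapBlock (f AB.a).toList (f AB.b).toList) ++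
          (((f AB.a).toList ++ (f AB.b).toList) ++ ((f AB.b).toList ++ (f AB.a).toList))) := by
      intro w
      rw [map_nonemptyWords_eq_lift]
      simp only [← hf]
      have e : FreeMonoid.lift (fun l => PresentedMonoid.mk (KnuthRel (α := Fin 4)) (f l)) =
          (PresentedMonoid.mk KnuthRel).comp (FreeMonoid.lift f) := by
        ext l
        simp
      rw [e, MonoidHom.comp_apply, plac]
      congr 1
      apply FreeMonoid.toList.injective
      rw [wordSubst_pad, map_mul (FreeMonoid.lift f), map_mul (FreeMonoid.lift f),
        FreeMonoid.toList_mul, FreeMonoid.toList_mul,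
        toList_lift_wordSubst]
      simp [wa, wb, FreeMonoid.toList_mul]
    rw [key, key]
    refine plac_pad_eq fun c i j n => ?_
    have := h.scores_iff c f i j n
    rwa [toList_lift_wordSubst, toList_lift_wordSubst] at this
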